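/- Let $\Gamma$ be a countable discrete amenable group, let $\Gamma\curvearrowright Y$ be a continuous action on a compact metrizable space, and let $\Gamma\curvearrowright G$ be an algebraic action, i.e. $G$ is a compact metrizable group on which $\Gamma$ acts by continuous automorphisms. Let $\sigma\colon\Gamma\times Y\to G$ be a continuous cocycle, i.e. a continuous map with $\sigma(st,y)=\sigma(s,ty)\cdot s(\sigma(t,y))$ for all $s,t\in\Gamma$, $y\in Y$. Let $Y\times_\sigma G$ be the space $Y\times G$ with the $\Gamma$-action $s(y,g)=(sy,\sigma(s,y)\cdot (sg))$, and let $\pi\colon Y\times_\sigma G\to Y$ be the projection. Fix a Følner sequence $(F_n)_n$ of $\Gamma$, i.e. nonempty finite sets $F_n\subseteq\Gamma$ with $|sF_n\Delta F_n|/|F_n|\to0$ for every $s\in\Gamma$. Then $$\operatorname{mdim}(Y\times_\sigma G)\le \operatorname{mdim}(Y)+\sup_{y\in Y}\operatorname{mdim}(\pi^{-1}(y)).$$ Here, for a finite open cover $\mathcal U$ of a space, $\mathcal D(\mathcal U)$ is the least value of $\operatorname{ord}(\mathcal W)=\max_x\sum_{W\in\mathcal W}1_W(x)-1$ over the finite open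 covers $\mathcal W$ refining $\mathcal U$. For a continuous action of $\Gamma$ on a compact metrizable space $X$, a finite open cover $\mathcal U$ of $X$ and a finite set $F\subseteq\Gamma$, $\mathcal U^F=\bigvee_{s\in F}s^{-1}\mathcal U$. The mean dimension of $X$ is $\operatorname{mdim}(X)=\sup_{\mathcal U}\lim_F \mathcal D(\mathcal U^F)/|F|\in[0,\infty]$, where $\mathcal U$ runs over the finite open covers of $X$ and the limit (which exists by the Ornstein–Weiss lemma) is taken as the nonempty finite set $F\subseteq\Gamma$ becomes more and more invariant, i.e. along the net of pairs $(K,\delta)$, with $K\subseteq\Gamma$ nonempty finite and $\delta>0$, and the sets $F$ with $|\{t\in F: Kt\subseteq F\}|\ge(1-\delta)|F|$. The mean dimension of a closed subset $K\subseteq X$ is $\operatorname{mdim}(K)=\sup_{\mathcal U}\limsup_{n\to\infty}\mathcal D(\mathcal U^{F_n}|_K)/|F_n|$, where $\mathcal U$ runs over the finite open covers of $X$ and $\mathcal U|_K=\{U\cap K:U\in\mathcal U\}$ is viewed as an open cover of $K$. -/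

import Mathlib

open Filter Topology
open scoped ENNReal

namespace MeanDim

noncomputable section

/-! ### Amenable groups -/

section Amenable

variable {Γ : Type*} [Group Γ]

/-- The set `𝓑(K, δ)` of nonempty finite `F ⊆ Γ` with `|{t ∈ F : K t ⊆ F}| ≥ (1 - δ) |F|`. -/
def almostInvariant (K : Finset Γ) (δ : ℝ) : Set (Finset Γ) :=
  {F | F.Nonempty ∧
    (1 - δ) * (F.card : ℝ) ≤ ({t : Γ | t ∈ F ∧ ∀ k ∈ K, k * t ∈ F}.ncard : ℝ)}

variable (Γ) in
/-- `Γ` is amenable: every `𝓑(K, δ)` is nonempty. -/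
def IsAmenable : Prop :=
  ∀ (K : Finset Γ) (δ : ℝ), K.Nonempty → 0 < δ → (almostInvariant K δ).Nonempty

variable (Γ) in
/-- The filter "as `F` becomes more and more invariant" on the finite subsets of `Γ`; it is
generated by the sets `𝓑(K, δ)`, `K` nonempty finite, `δ > 0`. -/
def invariantFilter : Filter (Finset Γ) :=
  ⨅ (K : Finset Γ) (_ : K.Nonempty) (δ : ℝ) (_ : 0 < δ), 𝓟 (almostInvariant K δ)

/-- A (left) Følner sequence: nonempty finite sets with `|s Fₙ ∆ Fₙ| / |Fₙ| → 0` for all `s`. -/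
structure IsFolnerSeq (F : ℕ → Finset Γ) : Prop where
  nonempty : ∀ n, (F n).Nonempty
  tendsto : ∀ s : Γ,
    Tendsto (fun n => ((symmDiff ((fun t => s * t) '' (F n : Set Γ)) (F n : Set Γ)).ncard : ℝ)
      / ((F n).card : ℝ)) atTop (𝓝 0)

end Amenable

/-! ### Finite open covers -/

section Covers

variable {X : Type*}

/-- `𝒰` is a finite open cover of `X`. -/
structure IsFinOpenCover [TopologicalSpace X] (𝒰 : Set (Set X)) : Prop where
  finite : 𝒰.Finite
  isOpen : ∀ U ∈ 𝒰, IsOpen U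
  covers : ⋃₀ 𝒰 = Set.univ

/-- `𝒲` refines `𝒰`: every member of `𝒲` is contained in some member of `𝒰`. -/
def Refines (𝒲 𝒰 : Set (Set X)) : Prop :=
  ∀ W ∈ 𝒲, ∃ U ∈ 𝒰, W ⊆ U

/-- The overlapping number `max_x ∑_{U ∈ 𝒰} 1_U(x) - 1`. -/
def ord (𝒰 : Set (Set X)) : ℕ∞ :=
  (⨆ x : X, {U | U ∈ 𝒰 ∧ x ∈ U}.encard) - 1

/-- `𝒟(𝒰)`: the least `ord 𝒲` over the finite open covers `𝒲` refining `𝒰`. -/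
def coverDim [TopologicalSpace X] (𝒰 : Set (Set X)) : ℕ∞ :=
  ⨅ (𝒲 : Set (Set X)) (_ : IsFinOpenCover 𝒲 ∧ Refines 𝒲 𝒰), ord 𝒲

/-- The join `𝒰^F = ⋁_{s ∈ F} s⁻¹ 𝒰`. -/
def joinCover {Γ : Type*} [Group Γ] [MulAction Γ X] (𝒰 : Set (Set X)) (F : Finset Γ) :
    Set (Set X) :=
  {V | ∃ u : Γ → Set X, (∀ s ∈ F, u s ∈ 𝒰) ∧ V = ⋂ s ∈ F, (fun x : X => s • x) ⁻¹' u s}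

/-- The restriction `𝒰|_K = {U ∩ K : U ∈ 𝒰}`, as a family of subsets of the subspace `K`. -/
def restrictCover (𝒰 : Set (Set X)) (K : Set X) : Set (Set K) :=
  (fun U : Set X => (Subtype.val : K → X) ⁻¹' U) '' 𝒰

end Covers

/-! ### Mean dimension -/

section MeanDimension

/-- The mean dimension `mdim(X) = sup_𝒰 lim_F 𝒟(𝒰^F) / |F|` of the system `Γ ↷ X`, with `𝒰`
ranging over the finite open covers of `X` and `F` becoming more and more invariant. For a
continuous action of an amenable group the limit exists by the Ornstein–Weiss lemma, so it agrees
with the upper limit that is used here. -/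
def mdim (Γ : Type*) [Group Γ] (X : Type*) [TopologicalSpace X] [MulAction Γ X] : ℝ≥0∞ :=
  ⨆ (𝒰 : Set (Set X)) (_ : IsFinOpenCover 𝒰),
    limsup (fun F : Finset Γ => (coverDim (joinCover 𝒰 F) : ℝ≥0∞) / (F.card : ℝ≥0∞))
      (invariantFilter Γ)

/-- The mean dimension `sup_𝒰 limsup_n 𝒟(𝒰^{Fₙ}|_K) / |Fₙ|` of a subset `K` of the system
`Γ ↷ X` along the sequence `Fₙ`, with `𝒰` ranging over the finite open covers of `X`. -/
def mdimOn {Γ : Type*} [Group Γ] {X : Type*} [TopologicalSpace X] [MulAction Γ X]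
    (F : ℕ → Finset Γ) (K : Set X) : ℝ≥0∞ :=
  ⨆ (𝒰 : Set (Set X)) (_ : IsFinOpenCover 𝒰),
    limsup (fun n : ℕ => (coverDim (restrictCover (joinCover 𝒰 (F n)) K) : ℝ≥0∞)
      / ((F n).card : ℝ≥0∞)) atTop

end MeanDimension

/-! ### Cocycles and skew products -/

section Skew

/-- A continuous cocycle `σ : Γ × Y → G`, with `σ(st, y) = σ(s, ty) · s(σ(t, y))`. As `Γ` is
discrete, continuity on `Γ × Y` is continuity of every `σ(s, ·)`. -/
structure Cocycle (Γ Y G : Type*) [Group Γ] [TopologicalSpace Y] [MulAction Γ Y]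
    [Group G] [TopologicalSpace G] [MulDistribMulAction Γ G] where
  toFun : Γ → Y → G
  continuous_toFun : ∀ s, Continuous (toFun s)
  map_mul : ∀ (s t : Γ) (y : Y), toFun (s * t) y = toFun s (t • y) * s • toFun t y

variable {Γ Y G : Type*} [Group Γ] [TopologicalSpace Y] [MulAction Γ Y]
  [Group G] [TopologicalSpace G] [MulDistribMulAction Γ G]

theorem Cocycle.map_one (σ : Cocycle Γ Y G) (y : Y) : σ.toFun 1 y = 1 := by
  have h := σ.map_mul 1 1 y
  simpa using h

/-- The underlying space `Y × G` of the skew product `Y ×_σ G`. -/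
def SkewProduct (_σ : Cocycle Γ Y G) : Type _ := Y × G

namespace SkewProduct

variable (σ : Cocycle Γ Y G)

instance : TopologicalSpace (SkewProduct σ) :=
  inferInstanceAs (TopologicalSpace (Y × G))

instance [CompactSpace Y] [CompactSpace G] : CompactSpace (SkewProduct σ) :=
  inferInstanceAs (CompactSpace (Y × G))

instance [TopologicalSpace.MetrizableSpace Y] [TopologicalSpace.MetrizableSpace G] :
    TopologicalSpace.MetrizableSpace (SkewProduct σ) :=
  inferInstanceAs (TopologicalSpace.MetrizableSpace (Y × G))

/-- The action `s (y, g) = (s y, σ(s, y) · (s g))`. -/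
instance : MulAction Γ (SkewProduct σ) where
  smul s p := ((s • p.1, σ.toFun s p.1 * s • p.2) : Y × G)
  one_smul p := by
    change ((_, _) : Y × G) = p
    rw [one_smul, one_smul, σ.map_one, one_mul]
    rfl
  mul_smul s t p := by
    change ((_, _) : Y × G) = (s • t • p.1, σ.toFun s (t • p.1) * s • (σ.toFun t p.1 * t • p.2))
    rw [σ.map_mul, mul_smul, mul_smul, smul_mul', mul_assoc]

instance [IsTopologicalGroup G] [ContinuousConstSMul Γ Y] [ContinuousConstSMul Γ G] :
    ContinuousConstSMul Γ (SkewProduct σ) where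
  continuous_const_smul s := by
    change Continuous fun p : Y × G => ((s • p.1, σ.toFun s p.1 * s • p.2) : Y × G)
    have := σ.continuous_toFun s
    fun_prop

/-- The factor map `π : Y ×_σ G → Y`. -/
def proj (p : SkewProduct σ) : Y := Prod.fst (α := Y) (β := G) p

end SkewProduct

end Skew

end

end MeanDim

/-! All fibers of the skew product look alike, so any single fiber already gives the bound. If `g`
and `g'` lie over `y`, then `s` sends them to `σ(s,y)·sg` and `σ(s,y)·sg'`. Over another point only
the left factor changes, and left translations of a compact group are uniformly equicontinuous. A
cover of `G` that controls the action of a finite set `T` over one `y` therefore controls it over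
every point (`dist_smul_lt_of_mem_fiberCover`). Together with a fine cover of `Y`, it controls `T`
on whole boxes `V × C` (`exists_cover_smul_mem`).

The fiber bound is known only along the sequence `F n`, whereas `mdim` concerns all sufficiently
invariant `A`. The Ornstein–Weiss quasi-tiling (`exists_quasitiling`) covers `A`, up to a proportion
`ε`, by almost disjoint translates `F n * c` of finitely many shapes. On the tile `F n * c` one uses
the fiber cover for `F n`, pulled back by `c`; on an uncovered `s` one uses `s⁻¹ 𝒰`. These covers
and the pullback of `𝒱^A` have a join refining `𝒰^A`, and `𝒟` is subadditive under joins
(`CoverDimLE.join`). With `S` the mean dimension of the fiber and `d` bounding `𝒟(𝒰)`, the cost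
beyond `𝒟(𝒱^A)` is at most `((S + ε)/(1 - ε) + ε d) |A|`. Finally `ε → 0`. -/

namespace MeanDim

/-! ### Order of finite open covers and subadditivity of `𝒟`. -/

section Covers

variable {X : Type*}

theorem ord_le_iff {𝒰 : Set (Set X)} {k : ℕ} :
    ord 𝒰 ≤ k ↔ ∀ x, {U | U ∈ 𝒰 ∧ x ∈ U}.encard ≤ k + 1 := by
  rw [ord, tsub_le_iff_right, iSup_le_iff]

theorem encard_image_preimage_le {Z : Type*} (f : Z → X) (𝒲 : Set (Set X)) (z : Z) :
    {W | W ∈ Set.preimage f '' 𝒲 ∧ z ∈ W}.encard ≤ {W | W ∈ 𝒲 ∧ f z ∈ W}.encard := by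
  refine (Set.encard_le_encard ?_).trans (Set.encard_image_le (Set.preimage f) _)
  rintro _ ⟨⟨W, hW, rfl⟩, hz⟩
  exact ⟨W, ⟨hW, hz⟩, rfl⟩

/-- The join of two covers. -/
def join (𝒰 𝒱 : Set (Set X)) : Set (Set X) := {W | ∃ U ∈ 𝒰, ∃ V ∈ 𝒱, W = U ∩ V}

/-- The join of a finite family of covers. -/
def finJoin {ι : Type*} (s : Finset ι) (𝒰 : ι → Set (Set X)) : Set (Set X) :=
  {W | ∃ u : ι → Set X, (∀ i ∈ s, u i ∈ 𝒰 i) ∧ W = ⋂ i ∈ s, u i}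

/-- A finite subset of a product of two linear orders that is a chain has at most `p + q - 1`
elements, where `p` and `q` are the sizes of its coordinate sets. -/
theorem card_lt_of_chain {α β : Type*} [LinearOrder α] [LinearOrder β] {S : Finset (α × β)}
    {A : Finset α} {B : Finset β} (hS : S ⊆ A ×ˢ B)
    (hchain : ∀ p ∈ S, ∀ q ∈ S, p.1 < q.1 → p.2 ≤ q.2) (hne : S.Nonempty) :
    S.card < A.card + B.card := by
  have hA : ∀ a ∈ A, (A.filter (· < a)).card < A.card := fun a ha =>
    Finset.card_lt_card (Finset.filter_ssubset.2 ⟨a, ha, lt_irrefl _⟩)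
  have hB : ∀ b ∈ B, (B.filter (· < b)).card < B.card := fun b hb =>
    Finset.card_lt_card (Finset.filter_ssubset.2 ⟨b, hb, lt_irrefl _⟩)
  have monoA : ∀ a ∈ A, ∀ a', a < a' → (A.filter (· < a)).card < (A.filter (· < a')).card := by
    intro a ha a' h
    refine Finset.card_lt_card (Finset.ssubset_iff_subset_ne.2 ⟨?_, fun h' => ?_⟩)
    · exact Finset.monotone_filter_right _ fun x _ hx => lt_trans hx h
    · have : a ∈ A.filter (· < a) := h' ▸ Finset.mem_filter.2 ⟨ha, h⟩
      exact lt_irrefl _ (Finset.mem_filter.1 this).2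
  have monoB : ∀ b ∈ B, ∀ b', b < b' → (B.filter (· < b)).card < (B.filter (· < b')).card := by
    intro b hb b' h
    refine Finset.card_lt_card (Finset.ssubset_iff_subset_ne.2 ⟨?_, fun h' => ?_⟩)
    · exact Finset.monotone_filter_right _ fun x _ hx => lt_trans hx h
    · have : b ∈ B.filter (· < b) := h' ▸ Finset.mem_filter.2 ⟨hb, h⟩
      exact lt_irrefl _ (Finset.mem_filter.1 this).2
  have monoB' : ∀ b b', b ≤ b' → (B.filter (· < b)).card ≤ (B.filter (· < b')).card :=
    fun b b' h => Finset.card_le_card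
      (Finset.monotone_filter_right _ fun x _ hx => lt_of_lt_of_le hx h)
  -- The sum of the two ranks is strictly increasing along the chain, hence injective. Ranks are at
  -- most `|A| - 1` and `|B| - 1`, so only `|A| + |B| - 1` values are possible.
  let r : α × β → ℕ := fun p => (A.filter (· < p.1)).card + (B.filter (· < p.2)).card
  have key : ∀ p ∈ S, ∀ q ∈ S, p.1 < q.1 → r p < r q := fun p hp q hq h =>
    add_lt_add_of_lt_of_le (monoA _ (Finset.mem_product.1 (hS hp)).1 _ h)
      (monoB' _ _ (hchain p hp q hq h))
  have key' : ∀ p ∈ S, ∀ q ∈ S, p.1 = q.1 → p.2 < q.2 → r p < r q := by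
    intro p hp q hq h h'
    have := monoB _ (Finset.mem_product.1 (hS hp)).2 _ h'
    simp only [r, h]
    omega
  have hinj : Set.InjOn r S := by
    intro p hp q hq hpq
    rcases lt_trichotomy p.1 q.1 with h | h | h
    · exact absurd hpq (key p hp q hq h).ne
    · rcases lt_trichotomy p.2 q.2 with h' | h' | h'
      · exact absurd hpq (key' p hp q hq h h').ne
      · exact Prod.ext h h'
      · exact absurd hpq (key' q hq p hp h.symm h').ne'
    · exact absurd hpq (key q hq p hp h).ne'
  have hle : S.card ≤ (Finset.range (A.card + B.card - 1)).card := by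
    refine Finset.card_le_card_of_injOn r (fun p hp => ?_) hinj
    have h1 := hA _ (Finset.mem_product.1 (hS hp)).1
    have h2 := hB _ (Finset.mem_product.1 (hS hp)).2
    simp only [Finset.coe_range, Set.mem_Iio, r]
    omega
  obtain ⟨p, hp⟩ := hne
  have h1 := hA _ (Finset.mem_product.1 (hS hp)).1
  rw [Finset.card_range] at hle
  omega

theorem exists_lt_le_lt_succ {n : ℕ} {a : ℕ → ℝ} {t : ℝ} (h0 : a 0 ≤ t) (hn : t < a n) :
    ∃ i < n, a i ≤ t ∧ t < a (i + 1) := by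
  induction n with
  | zero => exact absurd h0 (not_le.2 hn)
  | succ n ih =>
    by_cases h : t < a n
    · obtain ⟨i, hi, h'⟩ := ih h
      exact ⟨i, hi.trans n.lt_succ_self, h'⟩
    · exact ⟨n, n.lt_succ_self, not_lt.1 h, hn⟩

/-- Injectivity of `W` lets active indices be counted as distinct members of the cover. -/
theorem card_active_le {n k : ℕ} {𝒲 : Set (Set X)} {W : ℕ → Set X} {φ : ℕ → X → ℝ}
    (hinj : Set.InjOn W (Set.Iio n)) (hmem : ∀ i < n, W i ∈ 𝒲)
    (hpos : ∀ i < n, ∀ x, 0 < φ i x → x ∈ W i) {x : X}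
    (ho : {W | W ∈ 𝒲 ∧ x ∈ W}.encard ≤ k + 1) :
    ((Finset.range n).filter fun i => 0 < φ i x).card ≤ k + 1 := by
  have h : (((Finset.range n).filter fun i => 0 < φ i x : Finset ℕ) : Set ℕ).encard ≤
      {W | W ∈ 𝒲 ∧ x ∈ W}.encard := by
    refine Set.encard_le_encard_of_injOn (f := W) (fun i hi => ?_) (hinj.mono fun i hi => ?_)
    · simp only [Finset.coe_filter, Finset.mem_range] at hi
      exact ⟨hmem i hi.1, hpos i hi.1 x hi.2⟩
    · simp only [Finset.coe_filter, Finset.mem_range] at hi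
      exact hi.1
  rw [Set.encard_coe_eq_coe_finsetCard] at h
  exact_mod_cast h.trans ho

variable [TopologicalSpace X]

/-- A bound `k` for `𝒟(𝒰)`, witnessed by a finite open refinement of order at most `k`. -/
def CoverDimLE (𝒰 : Set (Set X)) (k : ℕ) : Prop :=
  ∃ 𝒲 : Set (Set X), IsFinOpenCover 𝒲 ∧ Refines 𝒲 𝒰 ∧
    ∀ x, {W | W ∈ 𝒲 ∧ x ∈ W}.encard ≤ k + 1

theorem coverDim_le_iff {𝒰 : Set (Set X)} {k : ℕ} : coverDim 𝒰 ≤ k ↔ CoverDimLE 𝒰 k := by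
  constructor
  · intro h
    have h1 : coverDim 𝒰 < (k : ℕ∞) + 1 :=
      h.trans_lt (by exact_mod_cast Nat.lt_succ_self k)
    rw [coverDim] at h1
    simp only [iInf_lt_iff] at h1
    obtain ⟨𝒲, ⟨h𝒲, hr⟩, hlt⟩ := h1
    exact ⟨𝒲, h𝒲, hr, ord_le_iff.1 (Order.le_of_lt_add_one hlt)⟩
  · rintro ⟨𝒲, h𝒲, hr, ho⟩
    exact (iInf₂_le 𝒲 ⟨h𝒲, hr⟩).trans (ord_le_iff.2 ho)

theorem IsFinOpenCover.exists_coverDimLE {𝒰 : Set (Set X)} (h : IsFinOpenCover 𝒰) :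
    ∃ k, CoverDimLE 𝒰 k := by
  refine ⟨𝒰.ncard, 𝒰, h, fun U hU => ⟨U, hU, subset_rfl⟩, fun x => ?_⟩
  rw [h.finite.cast_ncard_eq]
  exact (Set.encard_le_encard fun U hU => hU.1).trans le_self_add

theorem IsFinOpenCover.coe_coverDim_eq {𝒰 : Set (Set X)} (h : IsFinOpenCover 𝒰) :
    ∃ k : ℕ, coverDim 𝒰 = k ∧ CoverDimLE 𝒰 k := by
  obtain ⟨k, hk⟩ := h.exists_coverDimLE
  obtain ⟨m, hm⟩ := ENat.ne_top_iff_exists.1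
    (ne_top_of_le_ne_top (ENat.natCast_ne_top k) (coverDim_le_iff.2 hk))
  exact ⟨m, hm.symm, coverDim_le_iff.1 hm.symm.le⟩

theorem CoverDimLE.of_refines {𝒰 𝒱 : Set (Set X)} {k : ℕ} (h : CoverDimLE 𝒰 k)
    (hr : Refines 𝒰 𝒱) : CoverDimLE 𝒱 k := by
  obtain ⟨𝒲, h𝒲, hr', ho⟩ := h
  refine ⟨𝒲, h𝒲, fun W hW => ?_, ho⟩
  obtain ⟨U, hU, hWU⟩ := hr' W hW
  obtain ⟨V, hV, hUV⟩ := hr U hU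
  exact ⟨V, hV, hWU.trans hUV⟩

theorem IsFinOpenCover.preimage {Z : Type*} [TopologicalSpace Z] {𝒲 : Set (Set X)}
    (h : IsFinOpenCover 𝒲) {f : Z → X} (hf : Continuous f) :
    IsFinOpenCover (Set.preimage f '' 𝒲) where
  finite := h.finite.image _
  isOpen := by
    rintro _ ⟨W, hW, rfl⟩
    exact (h.isOpen W hW).preimage hf
  covers := by
    refine Set.eq_univ_of_forall fun z => ?_
    obtain ⟨W, hW, hz⟩ := Set.mem_sUnion.1 (h.covers.symm ▸ Set.mem_univ (f z))
    exact ⟨_, ⟨W, hW, rfl⟩, hz⟩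

theorem CoverDimLE.preimage {Z : Type*} [TopologicalSpace Z] {𝒰 : Set (Set X)} {k : ℕ}
    (h : CoverDimLE 𝒰 k) {f : Z → X} (hf : Continuous f) :
    CoverDimLE (Set.preimage f '' 𝒰) k := by
  obtain ⟨𝒲, h𝒲, hr, ho⟩ := h
  refine ⟨Set.preimage f '' 𝒲, h𝒲.preimage hf, ?_, fun z =>
    (encard_image_preimage_le f 𝒲 z).trans (ho _)⟩
  rintro _ ⟨W, hW, rfl⟩
  obtain ⟨U, hU, hWU⟩ := hr W hW
  exact ⟨_, ⟨U, hU, rfl⟩, Set.preimage_mono hWU⟩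

/-- Indexing by an initial segment of `ℕ` orders the partition of unity, so that its partial sums
can serve as breakpoints of `[0, 1]`. -/
theorem exists_partition_of_cover [NormalSpace X] {𝒲 : Set (Set X)} (h : IsFinOpenCover 𝒲) :
    ∃ (n : ℕ) (W : ℕ → Set X) (φ : ℕ → X → ℝ), Set.InjOn W (Set.Iio n) ∧ (∀ i < n, W i ∈ 𝒲) ∧
      (∀ i, Continuous (φ i)) ∧ (∀ i x, 0 ≤ φ i x) ∧ (∀ i < n, ∀ x, 0 < φ i x → x ∈ W i) ∧
      ∀ x, ∑ i ∈ Finset.range n, φ i x = 1 := by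
  classical
  have := h.finite.fintype
  let e := Fintype.equivFin 𝒲
  let n := Fintype.card 𝒲
  let W' : Fin n → Set X := fun i => (e.symm i : Set X)
  have hcov : (Set.univ : Set X) ⊆ ⋃ i, W' i := by
    intro x _
    obtain ⟨U, hU, hx⟩ := Set.mem_sUnion.1 (h.covers.symm ▸ Set.mem_univ x)
    exact Set.mem_iUnion.2 ⟨e ⟨U, hU⟩, by simpa [W'] using hx⟩
  obtain ⟨f, hf⟩ := BumpCovering.exists_isSubordinate_of_locallyFinite isClosed_univ W'
    (fun i => h.isOpen _ (e.symm i).2) (locallyFinite_of_finite _) hcov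
  let g := f.toPartitionOfUnity
  have hg : g.IsSubordinate W' := hf.toPartitionOfUnity
  refine ⟨n, fun i => if hi : i < n then W' ⟨i, hi⟩ else ∅,
    fun i x => if hi : i < n then g ⟨i, hi⟩ x else 0, ?_, ?_, ?_, ?_, ?_, ?_⟩
  · intro i hi j hj hij
    have hi' : i < n := hi
    have hj' : j < n := hj
    simp only [hi', hj', dif_pos, W'] at hij
    have := e.symm.injective (Subtype.ext hij)
    simpa using this
  · intro i hi
    simp only [hi, dif_pos]
    exact (e.symm _).2
  · intro i
    by_cases hi : i < n
    · simp only [hi, dif_pos]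
      exact (g _).continuous
    · simp only [hi, dif_neg, not_false_iff]
      exact continuous_const
  · intro i x
    by_cases hi : i < n
    · simp only [hi, dif_pos]
      exact g.nonneg _ _
    · simp [hi]
  · intro i hi x hx
    simp only [hi, dif_pos] at hx ⊢
    exact hg _ (subset_tsupport _ hx.ne')
  · intro x
    have := g.sum_eq_one (Set.mem_univ x)
    rw [finsum_eq_sum_of_fintype] at this
    rw [Finset.sum_range, ← this]
    simp

/-- **Subadditivity of `𝒟`** under joins. -/
theorem CoverDimLE.join [NormalSpace X] {𝒰 𝒱 : Set (Set X)} {k l : ℕ} (hk : CoverDimLE 𝒰 k)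
    (hl : CoverDimLE 𝒱 l) : CoverDimLE (join 𝒰 𝒱) (k + l) := by
  classical
  obtain ⟨𝒲, h𝒲, hr𝒲, ho𝒲⟩ := hk
  obtain ⟨𝒵, h𝒵, hr𝒵, ho𝒵⟩ := hl
  obtain ⟨n, W, φ, hWinj, hW, hφc, hφ0, hφW, hφ1⟩ := exists_partition_of_cover h𝒲
  obtain ⟨m, Z, ψ, hZinj, hZ, hψc, hψ0, hψZ, hψ1⟩ := exists_partition_of_cover h𝒵
  -- At each `x` the two partitions of unity cut `[0, 1]` into at most `k + 1` and `l + 1`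
  -- nondegenerate intervals. Indexing the new cover by overlapping pairs of intervals gives at most
  -- `k + l + 1` sets at `x`, where plain intersections could give `(k + 1)(l + 1)`.
  let a : ℕ → X → ℝ := fun i x => ∑ i' ∈ Finset.range i, φ i' x
  let b : ℕ → X → ℝ := fun j x => ∑ j' ∈ Finset.range j, ψ j' x
  have hac : ∀ i, Continuous (a i) := fun i => continuous_finsetSum _ fun j _ => hφc j
  have hbc : ∀ i, Continuous (b i) := fun i => continuous_finsetSum _ fun j _ => hψc j
  have has : ∀ i x, a (i + 1) x = a i x + φ i x := fun i x => Finset.sum_range_succ _ _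
  have hbs : ∀ i x, b (i + 1) x = b i x + ψ i x := fun i x => Finset.sum_range_succ _ _
  have ham : ∀ x, Monotone fun i => a i x := fun x => monotone_nat_of_le_succ fun i => by
    rw [has]; linarith [hφ0 i x]
  have hbm : ∀ x, Monotone fun i => b i x := fun x => monotone_nat_of_le_succ fun i => by
    rw [hbs]; linarith [hψ0 i x]
  -- the points where the `i`-th interval of the first and the `j`-th of the second overlap
  let O : ℕ × ℕ → Set X := fun p =>
    {x | max (a p.1 x) (b p.2 x) < min (a (p.1 + 1) x) (b (p.2 + 1) x)}
  have hO : ∀ p x, x ∈ O p ↔ (a p.1 x < a (p.1 + 1) x ∧ b p.2 x < a (p.1 + 1) x) ∧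
      a p.1 x < b (p.2 + 1) x ∧ b p.2 x < b (p.2 + 1) x := by
    intro p x
    rw [show x ∈ O p ↔ max (a p.1 x) (b p.2 x) < min (a (p.1 + 1) x) (b (p.2 + 1) x) from Iff.rfl,
      lt_min_iff, max_lt_iff, max_lt_iff]
  let R := Finset.range n ×ˢ Finset.range m
  refine ⟨O '' R, ⟨R.finite_toSet.image _, ?_, ?_⟩, ?_, fun x => ?_⟩
  · rintro _ ⟨p, -, rfl⟩
    exact isOpen_lt ((hac _).max (hbc _)) ((hac _).min (hbc _))
  · refine Set.eq_univ_of_forall fun x => ?_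
    -- The two half-open intervals containing `0` overlap to its right.
    obtain ⟨i, hi, hi1, hi2⟩ := exists_lt_le_lt_succ (n := n) (a := fun i => a i x) (t := 0)
      (by simp [a]) (by simp [a, hφ1])
    obtain ⟨j, hj, hj1, hj2⟩ := exists_lt_le_lt_succ (n := m) (a := fun i => b i x) (t := 0)
      (by simp [b]) (by simp [b, hψ1])
    refine ⟨O (i, j), ⟨(i, j), by simp [R, hi, hj], rfl⟩, (hO _ _).2 ?_⟩
    exact ⟨⟨hi1.trans_lt hi2, hj1.trans_lt hi2⟩, hi1.trans_lt hj2, hj1.trans_lt hj2⟩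
  · rintro _ ⟨⟨i, j⟩, hp, rfl⟩
    obtain ⟨hi, hj⟩ := Finset.mem_product.1 (Finset.mem_coe.1 hp)
    rw [Finset.mem_range] at hi hj
    obtain ⟨U, hU, hWU⟩ := hr𝒲 _ (hW i hi)
    obtain ⟨V, hV, hZV⟩ := hr𝒵 _ (hZ j hj)
    refine ⟨U ∩ V, ⟨U, hU, V, hV, rfl⟩, fun x hx => ?_⟩
    obtain ⟨⟨h1, -⟩, -, h2⟩ := (hO _ _).1 hx
    simp only [has, hbs] at h1 h2
    exact ⟨hWU (hφW i hi x (by linarith)), hZV (hψZ j hj x (by linarith))⟩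
  · let S := R.filter fun p => x ∈ O p
    have hS : S.card ≤ k + l + 1 := by
      rcases S.eq_empty_or_nonempty with h | h
      · simp [h]
      have hA := card_active_le hWinj hW hφW (ho𝒲 x)
      have hB := card_active_le hZinj hZ hψZ (ho𝒵 x)
      have := card_lt_of_chain (S := S) (A := (Finset.range n).filter fun i => 0 < φ i x)
        (B := (Finset.range m).filter fun i => 0 < ψ i x) ?_ ?_ h
      · omega
      · intro p hp
        obtain ⟨hp1, hp2⟩ := Finset.mem_filter.1 hp
        obtain ⟨hi, hj⟩ := Finset.mem_product.1 hp1
        obtain ⟨⟨h1, -⟩, -, h2⟩ := (hO _ _).1 hp2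
        rw [has] at h1
        rw [hbs] at h2
        exact Finset.mem_product.2 ⟨Finset.mem_filter.2 ⟨hi, by linarith⟩,
          Finset.mem_filter.2 ⟨hj, by linarith⟩⟩
      -- Overlapping pairs cannot cross: otherwise the `a`-interval of `p` precedes that of `q`
      -- while the `b`-intervals come in the opposite order.
      · intro p hp q hq hpq
        by_contra! hlt
        obtain ⟨⟨-, h1⟩, -, -⟩ := (hO _ _).1 (Finset.mem_filter.1 hp).2
        obtain ⟨-, h2, -⟩ := (hO _ _).1 (Finset.mem_filter.1 hq).2
        have h3 : a (p.1 + 1) x ≤ a q.1 x := ham x hpq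
        have h4 : b (q.2 + 1) x ≤ b p.2 x := hbm x hlt
        linarith
    calc {V | V ∈ O '' R ∧ x ∈ V}.encard ≤ (O '' (S : Set (ℕ × ℕ))).encard := by
          refine Set.encard_le_encard ?_
          rintro _ ⟨⟨p, hp, rfl⟩, hx⟩
          exact ⟨p, by simpa [S] using ⟨hp, hx⟩, rfl⟩
      _ ≤ (S : Set (ℕ × ℕ)).encard := Set.encard_image_le _ _
      _ = S.card := Set.encard_coe_eq_coe_finsetCard _
      _ ≤ ((k + l : ℕ) : ℕ∞) + 1 := by exact_mod_cast hS

theorem CoverDimLE.finJoin [NormalSpace X] {ι : Type*} {s : Finset ι} {𝒰 : ι → Set (Set X)}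
    {k : ι → ℕ} (h : ∀ i ∈ s, CoverDimLE (𝒰 i) (k i)) :
    CoverDimLE (finJoin s 𝒰) (∑ i ∈ s, k i) := by
  classical
  induction s using Finset.induction_on with
  | empty =>
    refine ⟨{Set.univ}, ⟨Set.finite_singleton _, by simp, by simp⟩, ?_, fun x => ?_⟩
    · rintro _ rfl
      exact ⟨_, ⟨fun _ => ∅, by simp, rfl⟩, by simp⟩
    · refine (Set.encard_le_encard (t := {Set.univ}) fun U hU => hU.1).trans ?_
      simp
  | insert i s hi ih =>
    rw [Finset.sum_insert hi]
    refine ((h i (Finset.mem_insert_self _ _)).join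
      (ih fun j hj => h j (Finset.mem_insert_of_mem hj))).of_refines ?_
    rintro _ ⟨U, hU, _, ⟨u, hu, rfl⟩, rfl⟩
    refine ⟨_, ⟨fun j => if j = i then U else u j, fun j hj => ?_, rfl⟩, ?_⟩
    · by_cases hji : j = i
      · simpa [hji] using hU
      · simpa [hji] using hu j ((Finset.mem_insert.1 hj).resolve_left hji)
    · rintro x ⟨hxU, hx⟩
      simp only [Set.mem_iInter] at hx ⊢
      intro j hj
      by_cases hji : j = i
      · simpa [hji] using hxU
      · simpa [hji] using hx j ((Finset.mem_insert.1 hj).resolve_left hji)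

theorem IsFinOpenCover.joinCover {Γ : Type*} [Group Γ] [MulAction Γ X] [ContinuousConstSMul Γ X]
    {𝒰 : Set (Set X)} (h : IsFinOpenCover 𝒰) (A : Finset Γ) :
    IsFinOpenCover (joinCover 𝒰 A) where
  finite := by
    classical
    have hfin : (Set.univ.pi fun _ : A => 𝒰).Finite := Set.Finite.pi fun _ => h.finite
    refine (hfin.image fun v : A → Set X => ⋂ s : A, (fun x : X => (s : Γ) • x) ⁻¹' v s).subset ?_
    rintro _ ⟨u, hu, rfl⟩
    refine ⟨fun s => u s, fun s _ => hu s s.2, ?_⟩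
    ext x
    simp
  isOpen := by
    rintro _ ⟨u, hu, rfl⟩
    exact isOpen_biInter_finset fun s hs => (h.isOpen _ (hu s hs)).preimage
      (continuous_const_smul s)
  covers := by
    refine Set.eq_univ_of_forall fun x => ?_
    have hx : ∀ s : Γ, ∃ U ∈ 𝒰, s • x ∈ U := fun s =>
      Set.mem_sUnion.1 (h.covers.symm ▸ Set.mem_univ (s • x))
    choose u hu hux using hx
    exact ⟨_, ⟨u, fun s _ => hu s, rfl⟩, by simpa using fun s _ => hux s⟩

/-- A compact metric space has finite covers by open balls of a given radius. -/
theorem exists_finOpenCover_dist_lt (Z : Type*) [PseudoMetricSpace Z] [CompactSpace Z] {r : ℝ}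
    (hr : 0 < r) : ∃ 𝒰 : Set (Set Z), IsFinOpenCover 𝒰 ∧
      ∀ U ∈ 𝒰, ∀ x ∈ U, ∀ y ∈ U, dist x y < r := by
  obtain ⟨t, -, ht, hcov⟩ := finite_cover_balls_of_compact (isCompact_univ (X := Z)) (half_pos hr)
  refine ⟨(fun z => Metric.ball z (r / 2)) '' t, ⟨ht.image _, ?_, ?_⟩, ?_⟩
  · rintro _ ⟨z, -, rfl⟩
    exact Metric.isOpen_ball
  · rw [Set.sUnion_image]
    exact Set.univ_subset_iff.1 hcov
  · rintro _ ⟨z, -, rfl⟩ x hx y hy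
    have := dist_triangle_right x y z
    rw [Metric.mem_ball] at hx hy
    linarith

end Covers

/-! ### Quasi-tilings by members of a Følner sequence. -/

section Tiling

variable {Γ : Type*} [Group Γ]

theorem almostInvariant_anti {K K' : Finset Γ} (hK : K ⊆ K') {δ δ' : ℝ} (hδ : δ' ≤ δ) :
    almostInvariant K' δ' ⊆ almostInvariant K δ := by
  rintro A ⟨hA, h⟩
  refine ⟨hA, le_trans (by gcongr) (h.trans ?_)⟩
  have hfin : {t : Γ | t ∈ A ∧ ∀ k ∈ K, k * t ∈ A}.Finite :=
    A.finite_toSet.subset fun t ht => ht.1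
  have hsub : {t : Γ | t ∈ A ∧ ∀ k ∈ K', k * t ∈ A} ⊆ {t : Γ | t ∈ A ∧ ∀ k ∈ K, k * t ∈ A} :=
    fun t ht => ⟨ht.1, fun k hk => ht.2 k (hK hk)⟩
  exact_mod_cast Set.ncard_le_ncard hsub hfin

variable [DecidableEq Γ]

/-- The points outside `B` that some element of `E` moves into `B`. -/
def outerBoundary (E B : Finset Γ) : Finset Γ :=
  (E.biUnion fun e => B.image fun b => e⁻¹ * b) \ B

theorem mem_outerBoundary {E B : Finset Γ} {c : Γ} :
    c ∈ outerBoundary E B ↔ (∃ e ∈ E, e * c ∈ B) ∧ c ∉ B := by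
  simp only [outerBoundary, Finset.mem_sdiff, Finset.mem_biUnion, Finset.mem_image]
  refine and_congr_left fun _ => exists_congr fun e => and_congr_right fun _ => ⟨?_, fun h => ?_⟩
  · rintro ⟨b, hb, rfl⟩
    simpa using hb
  · exact ⟨_, h, by simp⟩

theorem outerBoundary_mono {E E' : Finset Γ} (h : E ⊆ E') (B : Finset Γ) :
    outerBoundary E B ⊆ outerBoundary E' B := by
  intro c
  simp only [mem_outerBoundary]
  rintro ⟨⟨e, he, hc⟩, hB⟩
  exact ⟨⟨e, h he, hc⟩, hB⟩

theorem outerBoundary_union_subset (E B C : Finset Γ) :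
    outerBoundary E (B ∪ C) ⊆ outerBoundary E B ∪ outerBoundary E C := by
  intro c
  simp only [mem_outerBoundary, Finset.mem_union, not_or]
  rintro ⟨⟨e, he, hc | hc⟩, hB, hC⟩
  · exact Or.inl ⟨⟨e, he, hc⟩, hB⟩
  · exact Or.inr ⟨⟨e, he, hc⟩, hC⟩

/-- The right translate `T c`. -/
def rightTranslate (T : Finset Γ) (c : Γ) : Finset Γ := T.image fun t => t * c

theorem mem_rightTranslate {T : Finset Γ} {c x : Γ} :
    x ∈ rightTranslate T c ↔ x * c⁻¹ ∈ T := by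
  simp only [rightTranslate, Finset.mem_image]
  constructor
  · rintro ⟨t, ht, rfl⟩
    simpa using ht
  · exact fun h => ⟨_, h, by simp⟩

theorem card_rightTranslate (T : Finset Γ) (c : Γ) : (rightTranslate T c).card = T.card :=
  Finset.card_image_of_injective _ (mul_left_injective c)

/-- Boundaries are taken with left multiplications, which commute with right translations. -/
theorem card_outerBoundary_rightTranslate (E T : Finset Γ) (c : Γ) :
    (outerBoundary E (rightTranslate T c)).card = (outerBoundary E T).card := by
  rw [← card_rightTranslate (outerBoundary E T) c]
  congr 1
  ext x
  simp only [mem_rightTranslate, mem_outerBoundary, mul_assoc]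

theorem IsFolnerSeq.eventually_card_outerBoundary_le {F : ℕ → Finset Γ} (hF : IsFolnerSeq F)
    (E : Finset Γ) {η : ℝ} (hη : 0 < η) :
    ∀ᶠ n in atTop, ((outerBoundary E (F n)).card : ℝ) ≤ η * (F n).card := by
  have hE : (0 : ℝ) < E.card + 1 := by positivity
  have h : ∀ᶠ n in atTop, ∀ e ∈ E,
      ((symmDiff ((fun t => e⁻¹ * t) '' (F n : Set Γ)) (F n : Set Γ)).ncard : ℝ)
        / ((F n).card : ℝ) < η / (E.card + 1) := by
    rw [Filter.eventually_all_finset]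
    exact fun e _ => (hF.tendsto e⁻¹).eventually_lt_const (by positivity)
  filter_upwards [h] with n hn
  have hpos : (0 : ℝ) < (F n).card := by exact_mod_cast (hF.nonempty n).card_pos
  have hsub : outerBoundary E (F n) ⊆
      E.biUnion fun e => symmDiff ((F n).image fun t => e⁻¹ * t) (F n) := by
    intro c
    simp only [outerBoundary, Finset.mem_sdiff, Finset.mem_biUnion, Finset.mem_symmDiff]
    rintro ⟨⟨e, he, hc⟩, hB⟩
    exact ⟨e, he, Or.inl ⟨hc, hB⟩⟩
  have hle : ∀ e ∈ E, ((symmDiff ((F n).image fun t => e⁻¹ * t) (F n)).card : ℝ) ≤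
      η / (E.card + 1) * (F n).card := by
    intro e he
    have := hn e he
    rw [div_lt_iff₀ hpos, ← Finset.coe_image, ← Finset.coe_symmDiff,
      Set.ncard_coe_finset] at this
    exact this.le
  calc ((outerBoundary E (F n)).card : ℝ)
      ≤ ∑ e ∈ E, ((symmDiff ((F n).image fun t => e⁻¹ * t) (F n)).card : ℝ) := by
        exact_mod_cast (Finset.card_le_card hsub).trans Finset.card_biUnion_le
    _ ≤ ∑ e ∈ E, η / (E.card + 1) * (F n).card := Finset.sum_le_sum hle
    _ = E.card / (E.card + 1) * (η * (F n).card) := by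
        rw [Finset.sum_const, nsmul_eq_mul]; ring
    _ ≤ 1 * (η * (F n).card) := by
        gcongr
        rw [div_le_one hE]
        linarith
    _ = η * (F n).card := one_mul _

/-- The union of the tiles `F n * c`, `(n, c) ∈ P`. -/
def tileUnion (F : ℕ → Finset Γ) (P : Finset (ℕ × Γ)) : Finset Γ :=
  P.biUnion fun p => rightTranslate (F p.1) p.2

theorem mem_tileUnion {F : ℕ → Finset Γ} {P : Finset (ℕ × Γ)} {x : Γ} :
    x ∈ tileUnion F P ↔ ∃ p ∈ P, x * p.2⁻¹ ∈ F p.1 := by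
  simp [tileUnion, mem_rightTranslate]

/-- All tiles have index in `I`, center in `A`, and are contained in `A`. -/
def IsTileFamily (F : ℕ → Finset Γ) (I : Finset ℕ) (A : Finset Γ) (P : Finset (ℕ × Γ)) : Prop :=
  ∀ p ∈ P, p.1 ∈ I ∧ p.2 ∈ A ∧ ∀ t ∈ F p.1, t * p.2 ∈ A

theorem IsTileFamily.tileUnion_subset {F : ℕ → Finset Γ} {I : Finset ℕ} {A : Finset Γ}
    {P : Finset (ℕ × Γ)} (h : IsTileFamily F I A P) : tileUnion F P ⊆ A := by
  intro x hx
  obtain ⟨p, hp, hx⟩ := mem_tileUnion.1 hx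
  simpa using (h p hp).2.2 _ hx

/-- If every `c ∈ C` has more than an `ε`-fraction of `T c` inside `B`, then `ε |C| ≤ |B|`. -/
theorem mul_card_le_card_of_lt_card_inter {T C B : Finset Γ} (hT : T.Nonempty) {ε : ℝ}
    (h : ∀ c ∈ C, ε * T.card < (rightTranslate T c ∩ B).card) : ε * C.card ≤ B.card := by
  have hpos : (0 : ℝ) < T.card := by exact_mod_cast hT.card_pos
  -- Double counting of the pairs `(t, c)` with `t * c ∈ B`: for fixed `t`, `c` is determined by `t
  -- * c`.
  have hcount : ∑ c ∈ C, (rightTranslate T c ∩ B).card ≤ T.card * B.card := by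
    have h1 : ∀ c ∈ C, (rightTranslate T c ∩ B).card =
        (T.filter fun t => t * c ∈ B).card := by
      intro c _
      rw [← card_rightTranslate (T.filter fun t => t * c ∈ B) c]
      congr 1
      ext x
      simp [mem_rightTranslate]
    rw [Finset.sum_congr rfl h1]
    simp only [Finset.card_filter]
    rw [Finset.sum_comm]
    rw [← smul_eq_mul, ← Finset.sum_const]
    refine Finset.sum_le_sum fun t _ => ?_
    rw [← Finset.card_filter]
    refine Finset.card_le_card_of_injOn (fun c => t * c) ?_ ((mul_right_injective t).injOn)
    intro c hc
    exact (Finset.mem_filter.1 hc).2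
  have h2 : (C.card : ℝ) * (ε * T.card) ≤ T.card * B.card := by
    calc (C.card : ℝ) * (ε * T.card) = ∑ c ∈ C, ε * (T.card : ℝ) := by simp
      _ ≤ ∑ c ∈ C, ((rightTranslate T c ∩ B).card : ℝ) := Finset.sum_le_sum fun c hc => (h c hc).le
      _ ≤ T.card * B.card := by exact_mod_cast hcount
  nlinarith

/-- A maximal `ε`-disjoint extension of a tile family by tiles of index `n`. -/
theorem exists_maximal_tileFamily {F : ℕ → Finset Γ} (hne : ∀ n, (F n).Nonempty) {ε η : ℝ}
    (hε1 : ε < 1)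
    {E A : Finset Γ} {n : ℕ} (hn : ((outerBoundary E (F n)).card : ℝ) ≤ η * (F n).card)
    {I : Finset ℕ} {P₀ : Finset (ℕ × Γ)} (hP₀ : IsTileFamily F I A P₀)
    (hd : (1 - ε) * ∑ p ∈ P₀, ((F p.1).card : ℝ) ≤ (tileUnion F P₀).card)
    (hb : ((outerBoundary E (tileUnion F P₀)).card : ℝ) ≤ η * ∑ p ∈ P₀, ((F p.1).card : ℝ)) :
    ∃ P, P₀ ⊆ P ∧ IsTileFamily F (insert n I) A P ∧
      (1 - ε) * ∑ p ∈ P, ((F p.1).card : ℝ) ≤ (tileUnion F P).card ∧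
      ((outerBoundary E (tileUnion F P)).card : ℝ) ≤ η * ∑ p ∈ P, ((F p.1).card : ℝ) ∧
      ∀ c ∈ A, (∀ t ∈ F n, t * c ∈ A) →
        ε * (F n).card < (rightTranslate (F n) c ∩ tileUnion F P).card := by
  classical
  let Good : Finset (ℕ × Γ) → Prop := fun P => P₀ ⊆ P ∧ IsTileFamily F (insert n I) A P ∧
      (1 - ε) * ∑ p ∈ P, ((F p.1).card : ℝ) ≤ (tileUnion F P).card ∧
      ((outerBoundary E (tileUnion F P)).card : ℝ) ≤ η * ∑ p ∈ P, ((F p.1).card : ℝ)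
  have hG₀ : Good P₀ :=
    ⟨subset_rfl, fun p hp => ⟨Finset.mem_insert_of_mem (hP₀ p hp).1, (hP₀ p hp).2⟩, hd, hb⟩
  have hmem : ∀ P, Good P → P ∈ ((insert n I) ×ˢ A).powerset.filter Good := by
    intro P hP
    refine Finset.mem_filter.2 ⟨Finset.mem_powerset.2 fun p hp => ?_, hP⟩
    exact Finset.mem_product.2 ⟨(hP.2.1 p hp).1, (hP.2.1 p hp).2.1⟩
  -- The covered area is maximized. A further admissible tile meeting the union in at most `ε |F n|`
  -- points would keep the family good and add at least `(1 - ε) |F n| > 0` points.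
  obtain ⟨P, hP, hmax⟩ := Finset.exists_max_image (((insert n I) ×ˢ A).powerset.filter Good)
    (fun P => (tileUnion F P).card) ⟨P₀, hmem _ hG₀⟩
  obtain ⟨hPP, hfam, hdP, hbP⟩ := (Finset.mem_filter.1 hP).2
  refine ⟨P, hPP, hfam, hdP, hbP, fun c hcA hc => ?_⟩
  by_contra! hle
  have hpos : (0 : ℝ) < (F n).card := by exact_mod_cast (hne n).card_pos
  have hnot : (n, c) ∉ P := by
    intro hmem'
    have hsub : rightTranslate (F n) c ⊆ tileUnion F P := by
      intro x hx
      exact mem_tileUnion.2 ⟨_, hmem', mem_rightTranslate.1 hx⟩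
    rw [Finset.inter_eq_left.2 hsub, card_rightTranslate] at hle
    nlinarith
  have hU : tileUnion F (insert (n, c) P) = tileUnion F P ∪ rightTranslate (F n) c := by
    rw [tileUnion, Finset.biUnion_insert, Finset.union_comm]
    rfl
  have hcard : ((tileUnion F (insert (n, c) P)).card : ℝ) +
      (rightTranslate (F n) c ∩ tileUnion F P).card = (tileUnion F P).card + (F n).card := by
    rw [hU, Finset.inter_comm, ← card_rightTranslate (F n) c]
    exact_mod_cast Finset.card_union_add_card_inter _ _
  have hsum : ∑ p ∈ insert (n, c) P, ((F p.1).card : ℝ) =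
      (F n).card + ∑ p ∈ P, ((F p.1).card : ℝ) := Finset.sum_insert hnot
  have hbd : ((outerBoundary E (tileUnion F (insert (n, c) P))).card : ℝ) ≤
      (outerBoundary E (tileUnion F P)).card + (outerBoundary E (F n)).card := by
    rw [hU, ← card_outerBoundary_rightTranslate E (F n) c]
    exact_mod_cast (Finset.card_le_card (outerBoundary_union_subset _ _ _)).trans
      (Finset.card_union_le _ _)
  have hG : Good (insert (n, c) P) := by
    refine ⟨hPP.trans (Finset.subset_insert _ _), ?_, ?_, ?_⟩
    · intro p hp
      rcases Finset.mem_insert.1 hp with rfl | hp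
      · exact ⟨Finset.mem_insert_self _ _, hcA, hc⟩
      · exact hfam p hp
    · rw [hsum]; linarith
    · rw [hsum]; linarith
  have h3 : ((tileUnion F (insert (n, c) P)).card : ℝ) ≤ (tileUnion F P).card := by
    exact_mod_cast hmax _ (hmem _ hG)
  nlinarith

/-- If `B ⊇ B₀` meets every translate of `T` centered in the `T`-interior of `A` in more than an
`ε`-fraction, and `B₀` has small boundary, then `B` leaves uncovered at most about a
`(1 - ε)`-fraction of what `B₀` leaves uncovered. -/
theorem card_sdiff_le_of_lt_card_inter {A B₀ B T : Finset Γ} (hB₀A : B₀ ⊆ A) (hBA : B ⊆ A)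
    (hBB : B₀ ⊆ B) (hT : T.Nonempty) {ε η τ : ℝ} (hε : 0 ≤ ε) (hε2 : ε ≤ 1 / 2) (hη : 0 ≤ η)
    (hA : A ∈ almostInvariant T η) (hd : (1 - ε) * τ ≤ B₀.card)
    (hb : ((outerBoundary T B₀).card : ℝ) ≤ η * τ)
    (hmax : ∀ c ∈ A, (∀ t ∈ T, t * c ∈ A) → ε * T.card < (rightTranslate T c ∩ B).card) :
    ((A \ B).card : ℝ) ≤ (1 - ε) * (A \ B₀).card + ε * (3 * η * A.card) := by
  let A' := A.filter fun c => ∀ t ∈ T, t * c ∈ A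
  have hA' : (1 - η) * (A.card : ℝ) ≤ A'.card := by
    have h1 := hA.2
    have h2 : {t : Γ | t ∈ A ∧ ∀ k ∈ T, k * t ∈ A} = (A' : Set Γ) := by
      ext; simp [A']
    rwa [h2, Set.ncard_coe_finset] at h1
  -- For `c ∈ C` the translate `T c` misses `B₀`, so its large intersection with `B` consists of
  -- newly covered points.
  obtain ⟨C, hCdef⟩ : ∃ C, C = A' \ (B₀ ∪ outerBoundary T B₀) := ⟨_, rfl⟩
  have hcount : ε * C.card ≤ ((B \ B₀).card : ℝ) := by
    refine mul_card_le_card_of_lt_card_inter hT fun c hc => ?_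
    rw [hCdef] at hc
    obtain ⟨hcA', hcB⟩ := Finset.mem_sdiff.1 hc
    obtain ⟨hcA, hct⟩ := Finset.mem_filter.1 hcA'
    rw [Finset.mem_union, not_or] at hcB
    refine (hmax c hcA hct).trans_le ?_
    refine Nat.cast_le.2 (Finset.card_le_card fun x hx => ?_)
    obtain ⟨hx1, hx2⟩ := Finset.mem_inter.1 hx
    refine Finset.mem_inter.2 ⟨hx1, Finset.mem_sdiff.2 ⟨hx2, fun hx3 => hcB.2 ?_⟩⟩
    exact mem_outerBoundary.2 ⟨⟨x * c⁻¹, mem_rightTranslate.1 hx1, by simpa using hx3⟩, hcB.1⟩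
  have hC : (A'.card : ℝ) ≤ C.card + (B₀.card + (outerBoundary T B₀).card) := by
    have h1 : A'.card ≤ C.card + (B₀ ∪ outerBoundary T B₀).card := by
      rw [hCdef]
      exact Finset.card_le_card_sdiff_add_card
    exact_mod_cast h1.trans (Nat.add_le_add_left (Finset.card_union_le _ _) _)
  have e1 : ((A \ B₀).card : ℝ) = A.card - B₀.card := Finset.cast_card_sdiff hB₀A
  have e2 : ((A \ B).card : ℝ) = A.card - B.card := Finset.cast_card_sdiff hBA
  have e3 : ((B \ B₀).card : ℝ) = B.card - B₀.card := Finset.cast_card_sdiff hBB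
  have hA0 : (0 : ℝ) ≤ A.card := by positivity
  -- From `1 - ε ≥ 1 / 2`. The loss `3 * η * |A|` is `η |A|` for the non-interior of `A` plus `η τ ≤
  -- 2 η |A|` for the boundary of `B₀`.
  have hτ : τ ≤ 2 * A.card := by
    have h1 : (B₀.card : ℝ) ≤ A.card := by exact_mod_cast Finset.card_le_card hB₀A
    nlinarith
  have hτ' := mul_le_mul_of_nonneg_left hτ hη
  have hC2 : ((A \ B₀).card : ℝ) - 3 * η * A.card ≤ C.card := by
    rw [e1]; linarith
  have := mul_le_mul_of_nonneg_left hC2 hε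
  linarith

theorem IsFolnerSeq.exists_tileFamily {F : ℕ → Finset Γ} (hF : IsFolnerSeq F) (N : ℕ) {ε η : ℝ}
    (hε : 0 < ε) (hε2 : ε ≤ 1 / 2) (hη : 0 < η) (m : ℕ) :
    ∀ E : Finset Γ, ∃ I : Finset ℕ, (∀ n ∈ I, N ≤ n) ∧ ∃ K : Finset Γ, K.Nonempty ∧ ∃ δ > 0,
      ∀ A ∈ almostInvariant K δ, ∃ P, IsTileFamily F I A P ∧
        (1 - ε) * ∑ p ∈ P, ((F p.1).card : ℝ) ≤ (tileUnion F P).card ∧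
        ((outerBoundary E (tileUnion F P)).card : ℝ) ≤ η * ∑ p ∈ P, ((F p.1).card : ℝ) ∧
        ((A \ tileUnion F P).card : ℝ) ≤ ((1 - ε) ^ m + 3 * η * m) * A.card := by
  induction m with
  | zero =>
    intro E
    refine ⟨∅, by simp, {1}, by simp, 1, one_pos, fun A _ => ⟨∅, by simp [IsTileFamily], ?_⟩⟩
    have h0 : outerBoundary E (tileUnion F ∅) = ∅ := by
      ext c
      simp [mem_outerBoundary, tileUnion]
    rw [h0]
    simp [tileUnion]
  | succ m ih =>
    intro E
    -- The shape placed last is chosen first. The induction hypothesis for `E ∪ F n` then supplies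
    -- earlier tiles whose union has small boundary relative to `F n`; this is why `E` is quantified
    -- inside the induction.
    obtain ⟨n, hnN, hn⟩ := ((eventually_ge_atTop N).and
      (hF.eventually_card_outerBoundary_le E hη)).exists
    obtain ⟨I, hI, K, hK, δ, hδ, h⟩ := ih (E ∪ F n)
    refine ⟨insert n I, ?_, K ∪ F n, hK.mono Finset.subset_union_left, min δ η,
      lt_min hδ hη, fun A hA => ?_⟩
    · intro k hk
      rcases Finset.mem_insert.1 hk with rfl | hk
      exacts [hnN, hI k hk]
    obtain ⟨P₀, hfam₀, hd₀, hb₀, hc₀⟩ :=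
      h A (almostInvariant_anti Finset.subset_union_left (min_le_left _ _) hA)
    have hbE : ((outerBoundary E (tileUnion F P₀)).card : ℝ) ≤
        η * ∑ p ∈ P₀, ((F p.1).card : ℝ) := le_trans (by
      exact_mod_cast Finset.card_le_card (outerBoundary_mono Finset.subset_union_left _)) hb₀
    obtain ⟨P, hPP, hfam, hd, hb, hmax⟩ := exists_maximal_tileFamily hF.nonempty
      (by linarith) hn hfam₀ hd₀ hbE
    refine ⟨P, hfam, hd, hb, ?_⟩
    have hfin := card_sdiff_le_of_lt_card_inter hfam₀.tileUnion_subset hfam.tileUnion_subset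
      (Finset.biUnion_subset_biUnion_of_subset_left _ hPP) (hF.nonempty n) hε.le hε2 hη.le
      (almostInvariant_anti Finset.subset_union_right (min_le_right _ _) hA) hd₀ (le_trans (by
        exact_mod_cast Finset.card_le_card (outerBoundary_mono Finset.subset_union_right _)) hb₀)
      hmax
    refine hfin.trans ?_
    calc (1 - ε) * ((A \ tileUnion F P₀).card : ℝ) + ε * (3 * η * A.card)
        ≤ (1 - ε) * (((1 - ε) ^ m + 3 * η * m) * A.card) + 1 * (3 * η * A.card) := by
          gcongr <;> linarith
      _ ≤ ((1 - ε) ^ (m + 1) + 3 * η * ((m + 1 : ℕ) : ℝ)) * A.card := by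
        have : 0 ≤ ε * (3 * η * m * A.card) := by positivity
        push_cast
        rw [pow_succ]
        linarith

/-- **Quasi-tiling**: sufficiently invariant finite sets are covered, up to a small proportion, by
almost disjoint right translates of finitely many members of a Følner sequence. -/
theorem IsFolnerSeq.exists_quasitiling {F : ℕ → Finset Γ} (hF : IsFolnerSeq F) (N : ℕ) {ε : ℝ}
    (hε : 0 < ε) (hε2 : ε ≤ 1 / 2) :
    ∃ I : Finset ℕ, (∀ n ∈ I, N ≤ n) ∧ ∃ K : Finset Γ, K.Nonempty ∧ ∃ δ > 0,
      ∀ A ∈ almostInvariant K δ, ∃ P, IsTileFamily F I A P ∧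
        (1 - ε) * ∑ p ∈ P, ((F p.1).card : ℝ) ≤ A.card ∧
        ((A \ tileUnion F P).card : ℝ) ≤ ε * A.card := by
  -- Half of `ε` absorbs `(1 - ε) ^ m`; the choice of `η` below makes the other error `3 * η * m` at
  -- most `ε / 2`.
  obtain ⟨m, hm⟩ := exists_pow_lt_of_lt_one (half_pos hε) (show 1 - ε < 1 by linarith)
  obtain ⟨I, hI, K, hK, δ, hδ, h⟩ := hF.exists_tileFamily N hε hε2
    (η := ε / (6 * (m + 1))) (by positivity) m ∅
  refine ⟨I, hI, K, hK, δ, hδ, fun A hA => ?_⟩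
  obtain ⟨P, hP, hd, -, hc⟩ := h A hA
  refine ⟨P, hP, hd.trans ?_, hc.trans ?_⟩
  · exact_mod_cast Finset.card_le_card hP.tileUnion_subset
  · gcongr
    have : 3 * (ε / (6 * ((m : ℝ) + 1))) * m ≤ ε / 2 := by
      rw [mul_div_assoc', div_mul_eq_mul_div, div_le_div_iff₀ (by positivity) (by norm_num)]
      nlinarith
    linarith

end Tiling

/-! ### Uniform control of the fibers and the cover of the skew product. -/

section Skew

/-- Multiplication is uniformly continuous on the compact `G × G`, so smallness survives all left
translations at once; no invariant metric is needed. -/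
theorem exists_finOpenCover_dist_mul_lt (G : Type*) [PseudoMetricSpace G] [CompactSpace G]
    [Group G] [IsTopologicalGroup G] {r : ℝ} (hr : 0 < r) :
    ∃ ℬ : Set (Set G), IsFinOpenCover ℬ ∧
      ∀ B ∈ ℬ, ∀ b ∈ B, ∀ b' ∈ B, ∀ h : G, dist (h * b) (h * b') < r := by
  have huc : UniformContinuous fun p : G × G => p.1 * p.2 :=
    CompactSpace.uniformContinuous_of_continuous continuous_mul
  obtain ⟨δ, hδ, h⟩ := Metric.uniformContinuous_iff.1 huc r hr
  obtain ⟨ℬ, hℬ, hd⟩ := exists_finOpenCover_dist_lt G hδ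
  refine ⟨ℬ, hℬ, fun B hB b hb b' hb' g => h (a := (g, b)) (b := (g, b')) ?_⟩
  rw [Prod.dist_eq]
  simpa [hδ] using hd B hB b hb b' hb'

variable {Γ Y G : Type*} [Group Γ] [MulAction Γ Y] [Group G] [MulDistribMulAction Γ G]

theorem Cocycle.exists_finOpenCover_dist_lt [PseudoMetricSpace Y] [CompactSpace Y]
    [ContinuousConstSMul Γ Y] [PseudoMetricSpace G] [CompactSpace G] [IsTopologicalGroup G]
    (σ : Cocycle Γ Y G) (T : Finset Γ) {r : ℝ} (hr : 0 < r) :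
    ∃ 𝒱 : Set (Set Y), IsFinOpenCover 𝒱 ∧ ∀ V ∈ 𝒱, ∀ y ∈ V, ∀ y' ∈ V, ∀ s ∈ T,
      dist (s • y) (s • y') < r ∧ ∀ h : G, dist (σ.toFun s y * h) (σ.toFun s y' * h) < r := by
  have hev : ∀ᶠ δ in 𝓝[>] (0 : ℝ), ∀ s ∈ T, ∀ y y' : Y, dist y y' < δ →
      dist (s • y) (s • y') < r ∧ ∀ h : G, dist (σ.toFun s y * h) (σ.toFun s y' * h) < r := by
    rw [Filter.eventually_all_finset]
    intro s _
    have hc : Continuous fun p : Y × G => (s • p.1, σ.toFun s p.1 * p.2) := by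
      have := σ.continuous_toFun s
      fun_prop
    obtain ⟨δ, hδ, h⟩ := Metric.uniformContinuous_iff.1
      (CompactSpace.uniformContinuous_of_continuous hc) r hr
    filter_upwards [Ioo_mem_nhdsGT hδ] with δ' hδ' y y' hy
    have key : ∀ g : G, dist (s • y) (s • y') < r ∧
        dist (σ.toFun s y * g) (σ.toFun s y' * g) < r := by
      intro g
      have := h (a := (y, g)) (b := (y', g)) (by
        rw [Prod.dist_eq]
        simpa [hδ] using hy.trans hδ'.2)
      rw [Prod.dist_eq, max_lt_iff] at this
      exact this
    exact ⟨(key 1).1, fun g => (key g).2⟩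
  obtain ⟨δ, h, hδ⟩ := (hev.and self_mem_nhdsWithin).exists
  obtain ⟨𝒱, h𝒱, hd⟩ := MeanDim.exists_finOpenCover_dist_lt Y hδ
  exact ⟨𝒱, h𝒱, fun V hV y hy y' hy' s hs => h s hs y y' (hd V hV y hy y' hy')⟩

variable [TopologicalSpace Y] [TopologicalSpace G]

/-- The coordinate `Y ×_σ G → G`. -/
def SkewProduct.fiberCoord (σ : Cocycle Γ Y G) (p : SkewProduct σ) : G :=
  Prod.snd (α := Y) (β := G) p

theorem SkewProduct.continuous_fiberCoord (σ : Cocycle Γ Y G) :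
    Continuous (SkewProduct.fiberCoord σ) :=
  continuous_snd (X := Y) (Y := G)

theorem SkewProduct.continuous_proj (σ : Cocycle Γ Y G) : Continuous (SkewProduct.proj σ) :=
  continuous_fst (X := Y) (Y := G)

/-- The cover of `G` induced by `ℬ` and the action of `T` on the fiber over `y`. -/
def fiberCover (σ : Cocycle Γ Y G) (ℬ : Set (Set G)) (T : Finset Γ) (y : Y) : Set (Set G) :=
  {C | ∃ u : Γ → Set G, (∀ s ∈ T, u s ∈ ℬ) ∧ C = {g | ∀ s ∈ T, σ.toFun s y * s • g ∈ u s}}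

/-- Pullback along the parametrization `g ↦ (y, g)` of the fiber. -/
theorem coverDimLE_fiberCover (σ : Cocycle Γ Y G) (ℬ : Set (Set G)) (T : Finset Γ) (y : Y)
    {k : ℕ} (h : CoverDimLE (restrictCover
      (joinCover (Set.preimage (SkewProduct.fiberCoord σ) '' ℬ) T)
      (SkewProduct.proj σ ⁻¹' {y})) k) : CoverDimLE (fiberCover σ ℬ T y) k := by
  let f : G → (SkewProduct.proj σ ⁻¹' {y} : Set (SkewProduct σ)) := fun g => ⟨((y, g) : Y × G), rfl⟩
  have hf : Continuous f := by
    refine Continuous.subtype_mk ?_ _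
    exact (Continuous.prodMk continuous_const continuous_id : Continuous fun g : G => (y, g))
  refine (h.preimage hf).of_refines ?_
  rintro _ ⟨_, ⟨_, ⟨u, hu, rfl⟩, rfl⟩, rfl⟩
  have hu' : ∀ s, ∃ B : Set G, s ∈ T → B ∈ ℬ ∧ Set.preimage (SkewProduct.fiberCoord σ) B = u s := by
    intro s
    by_cases hs : s ∈ T
    · obtain ⟨B, hB⟩ := hu s hs
      exact ⟨B, fun _ => hB⟩
    · exact ⟨∅, fun h => absurd h hs⟩
  choose v hv using hu'
  refine ⟨_, ⟨v, fun s hs => (hv s hs).1, rfl⟩, fun g hg s hs => ?_⟩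
  have hg' : ((y, g) : Y × G) ∈ ⋂ s ∈ T, (fun x : SkewProduct σ => s • x) ⁻¹' u s := hg
  have := Set.mem_iInter₂.1 hg' s hs
  rw [← (hv s hs).2] at this
  exact this

/-- Writing `h * s • g` as `(h * σ(s,y)⁻¹) * (σ(s,y) * s • g)` reduces to uniformity over left
translations. With `h` the cocycle value at another base point, the cover made over `y` works over
that point. -/
theorem dist_smul_lt_of_mem_fiberCover {G : Type*} [Group G] [MulDistribMulAction Γ G]
    [PseudoMetricSpace G] (σ : Cocycle Γ Y G) {ℬ : Set (Set G)} {r : ℝ}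
    (hℬ : ∀ B ∈ ℬ, ∀ b ∈ B, ∀ b' ∈ B, ∀ h : G, dist (h * b) (h * b') < r) {T : Finset Γ} {y : Y}
    {C : Set G} (hC : C ∈ fiberCover σ ℬ T y) {g g' : G} (hg : g ∈ C) (hg' : g' ∈ C) {s : Γ}
    (hs : s ∈ T) (h : G) : dist (h * s • g) (h * s • g') < r := by
  obtain ⟨u, hu, rfl⟩ := hC
  have := hℬ _ (hu s hs) _ (hg s hs) _ (hg' s hs) (h * (σ.toFun s y)⁻¹)
  simpa [mul_assoc] using this

/-- For a finite open cover `𝒰` of the skew product there is a finite open cover `ℬ` of `G` such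
that, for every finite `T ⊆ Γ`, over a fine enough cover of `Y` the sets `V × C`, with `C` in the
cover of `G` induced by `ℬ` and the action on any fiber, are sent into members of `𝒰` by `T`. -/
theorem SkewProduct.exists_cover_smul_mem {Y G : Type*} [MetricSpace Y] [CompactSpace Y]
    [MulAction Γ Y] [ContinuousConstSMul Γ Y] [MetricSpace G] [CompactSpace G] [Group G]
    [IsTopologicalGroup G] [MulDistribMulAction Γ G] [Nonempty Y] (σ : Cocycle Γ Y G)
    {𝒰 : Set (Set (SkewProduct σ))} (h𝒰 : IsFinOpenCover 𝒰) :
    ∃ ℬ : Set (Set G), IsFinOpenCover ℬ ∧ ∀ T : Finset Γ, ∃ 𝒱 : Set (Set Y),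
      IsFinOpenCover 𝒱 ∧ ∀ T' ⊆ T, ∀ y : Y, ∀ V ∈ 𝒱, ∀ C ∈ fiberCover σ ℬ T' y, ∀ s ∈ T',
        ∃ U ∈ 𝒰, ∀ x : SkewProduct σ, proj σ x ∈ V → fiberCoord σ x ∈ C → s • x ∈ U := by
  let 𝒰' : Set (Set (Y × G)) := 𝒰
  obtain ⟨e, he, hU⟩ := lebesgue_number_lemma_of_metric_sUnion (s := (Set.univ : Set (Y × G)))
    (c := 𝒰') isCompact_univ h𝒰.isOpen h𝒰.covers.ge
  obtain ⟨ℬ, hℬ, hℬd⟩ := exists_finOpenCover_dist_mul_lt G (half_pos he)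
  -- `ℬ` precedes `T`: it fixes the fiber growth and hence the tile shapes, while `𝒱` may depend on
  -- those shapes.
  refine ⟨ℬ, hℬ, fun T => ?_⟩
  obtain ⟨𝒱, h𝒱, h𝒱d⟩ := σ.exists_finOpenCover_dist_lt T (half_pos he)
  refine ⟨𝒱, h𝒱, fun T' hT y V hV C hC s hs => ?_⟩
  -- An empty box still requires some member of `𝒰`, which exists because `Y` is nonempty.
  by_cases hne : ∃ x : SkewProduct σ, proj σ x ∈ V ∧ fiberCoord σ x ∈ C
  · obtain ⟨x₀, hx₀V, hx₀C⟩ := hne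
    obtain ⟨U, hUm, hball⟩ := hU (s • x₀ : SkewProduct σ) (Set.mem_univ _)
    refine ⟨U, hUm, fun x hxV hxC => hball ?_⟩
    obtain ⟨h1, h2⟩ := h𝒱d V hV _ hxV _ hx₀V s (hT hs)
    have h3 := dist_smul_lt_of_mem_fiberCover σ hℬd hC hxC hx₀C hs (σ.toFun s (proj σ x₀))
    have h4 := dist_triangle (σ.toFun s (proj σ x) * s • fiberCoord σ x)
      (σ.toFun s (proj σ x₀) * s • fiberCoord σ x) (σ.toFun s (proj σ x₀) * s • fiberCoord σ x₀)
    have h5 := h2 (s • fiberCoord σ x)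
    have h6 : max (dist (s • proj σ x) (s • proj σ x₀))
        (dist (σ.toFun s (proj σ x) * s • fiberCoord σ x)
          (σ.toFun s (proj σ x₀) * s • fiberCoord σ x₀)) < e :=
      max_lt (by linarith) (by linarith)
    exact h6
  · obtain ⟨y₁⟩ := ‹Nonempty Y›
    obtain ⟨U, hU, -⟩ := Set.mem_sUnion.1
      (h𝒰.covers.symm ▸ Set.mem_univ ((y₁, 1) : Y × G) : ((y₁, 1) : Y × G) ∈ ⋃₀ 𝒰)
    exact ⟨U, hU, fun x hxV hxC => absurd ⟨x, hxV, hxC⟩ hne⟩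

/-- The estimate for `𝒟(𝒰^A)` obtained from tiles contained in `A`. -/
theorem SkewProduct.coverDimLE_joinCover [DecidableEq Γ] (σ : Cocycle Γ Y G)
    [NormalSpace (SkewProduct σ)] [ContinuousConstSMul Γ (SkewProduct σ)]
    {𝒰 : Set (Set (SkewProduct σ))} {𝒱 : Set (Set Y)} {𝒞 : ℕ → Set (Set G)}
    {F : ℕ → Finset Γ} {I : Finset ℕ} {A : Finset Γ} {P : Finset (ℕ × Γ)}
    (hP : IsTileFamily F I A P)
    (hUVC : ∀ n ∈ I, ∀ V ∈ 𝒱, ∀ C ∈ 𝒞 n, ∀ s ∈ F n,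
      ∃ U ∈ 𝒰, ∀ x : SkewProduct σ, proj σ x ∈ V → fiberCoord σ x ∈ C → s • x ∈ U)
    {v d : ℕ} {k : ℕ → ℕ} (hv : CoverDimLE (joinCover 𝒱 A) v)
    (hk : ∀ n ∈ I, CoverDimLE (𝒞 n) (k n)) (hd : CoverDimLE 𝒰 d) :
    CoverDimLE (joinCover 𝒰 A) (v + (∑ p ∈ P, k p.1 + (A \ tileUnion F P).card * d)) := by
  -- Pulling back by the center `c` costs nothing extra, so every translate of `F n` costs the same
  -- `k n`.
  have h1 : CoverDimLE (finJoin P fun p => Set.preimage (fun x : SkewProduct σ =>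
      fiberCoord σ (p.2 • x)) '' 𝒞 p.1) (∑ p ∈ P, k p.1) :=
    CoverDimLE.finJoin fun p hp => (hk p.1 (hP p hp).1).preimage
      ((continuous_fiberCoord σ).comp (continuous_const_smul p.2))
  have h2 : CoverDimLE (finJoin (A \ tileUnion F P) fun s => Set.preimage (fun x : SkewProduct σ =>
      s • x) '' 𝒰) (∑ _s ∈ A \ tileUnion F P, d) :=
    CoverDimLE.finJoin fun s _ => hd.preimage (continuous_const_smul s)
  rw [Finset.sum_const, smul_eq_mul] at h2
  refine ((hv.preimage (continuous_proj σ)).join (h1.join h2)).of_refines ?_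
  rintro _ ⟨_, ⟨_, ⟨w, hw, rfl⟩, rfl⟩, _, ⟨_, ⟨c, hc, rfl⟩, _, ⟨u, hu, rfl⟩, rfl⟩, rfl⟩
  have key : ∀ s : Γ, ∃ U, s ∈ A → U ∈ 𝒰 ∧ ∀ x : SkewProduct σ,
      (∀ t ∈ A, t • proj σ x ∈ w t) → (∀ p ∈ P, x ∈ c p) →
      (∀ t ∈ A \ tileUnion F P, x ∈ u t) → s • x ∈ U := by
    intro s
    by_cases hsA : s ∈ A
    swap
    · exact ⟨∅, fun h => absurd h hsA⟩
    by_cases hs : s ∈ tileUnion F P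
    -- Here `s = t * c` with `t ∈ F n`, so `s • x = t • (c • x)`. The center lies in `A`, so the
    -- join over `A` places `c • proj σ x` in a member of `𝒱`.
    · obtain ⟨p, hp, hsp⟩ := mem_tileUnion.1 hs
      obtain ⟨C, hC, hCp⟩ := hc p hp
      obtain ⟨hpI, hpA, -⟩ := hP p hp
      obtain ⟨U, hU, h⟩ := hUVC p.1 hpI _ (hw p.2 hpA) C hC _ hsp
      refine ⟨U, fun _ => ⟨hU, fun x hx1 hx2 _ => ?_⟩⟩
      have := h (p.2 • x) (hx1 p.2 hpA) (by
        have := hx2 p hp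
        rw [← hCp] at this
        exact this)
      rwa [smul_smul, inv_mul_cancel_right] at this
    · obtain ⟨U, hU, hUs⟩ := hu s (Finset.mem_sdiff.2 ⟨hsA, hs⟩)
      refine ⟨U, fun _ => ⟨hU, fun x _ _ hx => ?_⟩⟩
      have := hx s (Finset.mem_sdiff.2 ⟨hsA, hs⟩)
      rw [← hUs] at this
      exact this
  choose U hU using key
  refine ⟨_, ⟨U, fun s hs => (hU s hs).1, rfl⟩, ?_⟩
  rintro x ⟨hx1, hx2, hx3⟩
  refine Set.mem_iInter₂.2 fun s hs => (hU s hs).2 x ?_ ?_ ?_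
  · exact Set.mem_iInter₂.1 (show proj σ x ∈ _ from hx1)
  · exact Set.mem_iInter₂.1 hx2
  · exact Set.mem_iInter₂.1 hx3

end Skew

/-! ### Passage to the limit and conclusion. -/

theorem limsup_le_add_of_eventually_le {ι : Type*} {l : Filter ι} {f g : ι → ℝ≥0∞} {c : ℝ≥0∞}
    (h : ∀ᶠ i in l, f i ≤ g i + c) : limsup f l ≤ limsup g l + c := by
  rw [limsup_eq (u := g), ENNReal.sInf_add]
  refine le_iInf₂ fun b hb => limsup_le_of_le (h := ?_)
  filter_upwards [h, hb] with i hi hbi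
  exact hi.trans (by gcongr)

theorem almostInvariant_mem_invariantFilter {Γ : Type*} [Group Γ] {K : Finset Γ}
    (hK : K.Nonempty) {δ : ℝ} (hδ : 0 < δ) : almostInvariant K δ ∈ invariantFilter Γ :=
  mem_iInf_of_mem K (mem_iInf_of_mem hK (mem_iInf_of_mem δ (mem_iInf_of_mem hδ
    (mem_principal_self _))))

theorem mdim_eq_zero_of_isEmpty (Γ X : Type*) [Group Γ] [TopologicalSpace X] [MulAction Γ X]
    [IsEmpty X] : mdim Γ X = 0 := by
  refine le_antisymm (iSup₂_le fun 𝒰 _ => limsup_le_of_le (h := ?_)) zero_le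
  refine Eventually.of_forall fun A => ?_
  have h : coverDim (joinCover 𝒰 A) ≤ (0 : ℕ) := coverDim_le_iff.2
    ⟨∅, ⟨Set.finite_empty, by simp, Set.eq_univ_of_forall fun x => isEmptyElim x⟩,
      by simp [Refines], fun x => isEmptyElim x⟩
  have h0 : coverDim (joinCover 𝒰 A) = 0 := by simpa using h
  simp [h0]

variable {Γ Y G : Type*} [Group Γ] [MetricSpace Y] [CompactSpace Y]
    [MulAction Γ Y] [ContinuousConstSMul Γ Y] [Group G] [MetricSpace G] [IsTopologicalGroup G]
    [CompactSpace G] [MulDistribMulAction Γ G] [ContinuousConstSMul Γ G]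

theorem SkewProduct.limsup_coverDim_le (σ : Cocycle Γ Y G) {F : ℕ → Finset Γ}
    (hF : IsFolnerSeq F) (y : Y) {𝒰 : Set (Set (SkewProduct σ))} (h𝒰 : IsFinOpenCover 𝒰) {d : ℕ}
    (hd : CoverDimLE 𝒰 d) {S ε : ℝ} (hS : mdimOn F (proj σ ⁻¹' {y}) ≤ ENNReal.ofReal S)
    (hS0 : 0 ≤ S) (hε : 0 < ε) (hε2 : ε ≤ 1 / 2) :
    limsup (fun A : Finset Γ => (coverDim (joinCover 𝒰 A) : ℝ≥0∞) / (A.card : ℝ≥0∞))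
      (invariantFilter Γ) ≤ mdim Γ Y + ENNReal.ofReal ((S + ε) / (1 - ε) + ε * d) := by
  classical
  have : Nonempty Y := ⟨y⟩
  obtain ⟨ℬ, hℬ, hℬV⟩ := exists_cover_smul_mem σ h𝒰
  have hℬ' : IsFinOpenCover (Set.preimage (fiberCoord σ) '' ℬ) :=
    hℬ.preimage (continuous_fiberCoord σ)
  have hk : ∀ n, ∃ k : ℕ, coverDim (restrictCover
      (joinCover (Set.preimage (fiberCoord σ) '' ℬ) (F n)) (proj σ ⁻¹' {y})) = k ∧
      CoverDimLE (restrictCover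
        (joinCover (Set.preimage (fiberCoord σ) '' ℬ) (F n)) (proj σ ⁻¹' {y})) k := fun n =>
    ((hℬ'.joinCover (F n)).preimage continuous_subtype_val).coe_coverDim_eq
  choose k hk hkC using hk
  have hlim : limsup (fun n => ((k n : ℕ) : ℝ≥0∞) / ((F n).card : ℝ≥0∞)) atTop <
      ENNReal.ofReal (S + ε) := by
    refine lt_of_le_of_lt (le_trans ?_ hS) ((ENNReal.ofReal_lt_ofReal_iff (by linarith)).2
      (by linarith : S < S + ε))
    refine le_trans (le_of_eq ?_) (le_iSup₂ (f := fun 𝒲 _ => limsup (fun n : ℕ =>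
      (coverDim (restrictCover (joinCover 𝒲 (F n)) (proj σ ⁻¹' {y})) : ℝ≥0∞)
      / ((F n).card : ℝ≥0∞)) atTop) _ hℬ')
    simp only [hk, ENat.toENNReal_coe]
  obtain ⟨N, hN⟩ := eventually_atTop.1 (eventually_lt_of_limsup_lt hlim)
  have hkN : ∀ n ≥ N, (k n : ℝ) ≤ (S + ε) * (F n).card := by
    intro n hn
    have hpos := (hF.nonempty n).card_pos
    have h := (ENNReal.div_le_iff (by simpa using hpos.ne') (ENNReal.natCast_ne_top _)).1
      (hN n hn).le
    rw [← ENNReal.ofReal_natCast, ← ENNReal.ofReal_natCast,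
      ← ENNReal.ofReal_mul (by linarith)] at h
    exact (ENNReal.ofReal_le_ofReal_iff (by positivity)).1 h
  obtain ⟨I, hI, K, hK, δ, hδ, htile⟩ := hF.exists_quasitiling N hε hε2
  obtain ⟨𝒱, h𝒱, hUVC⟩ := hℬV (I.biUnion F)
  refine le_trans (limsup_le_add_of_eventually_le (g := fun A : Finset Γ =>
    (coverDim (joinCover 𝒱 A) : ℝ≥0∞) / (A.card : ℝ≥0∞)) ?_)
    (add_le_add_left (le_iSup₂ (f := fun 𝒲 _ => limsup (fun A : Finset Γ =>
      (coverDim (joinCover 𝒲 A) : ℝ≥0∞) / (A.card : ℝ≥0∞)) (invariantFilter Γ)) 𝒱 h𝒱) _)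
  filter_upwards [almostInvariant_mem_invariantFilter hK hδ] with A hA
  obtain ⟨P, hP, hPsum, hPrest⟩ := htile A hA
  obtain ⟨v, hv, hvC⟩ := (h𝒱.joinCover A).coe_coverDim_eq
  have hbound := coverDim_le_iff.2 (coverDimLE_joinCover σ hP (𝒞 := fun n => fiberCover σ ℬ (F n) y)
    (fun n hn V hV C hC s hs => hUVC (F n) (Finset.subset_biUnion_of_mem F hn) y V hV C hC s hs)
    hvC (fun n _ => coverDimLE_fiberCover σ ℬ (F n) y (hkC n)) hd)
  have hApos : (0 : ℝ) < A.card := by exact_mod_cast hA.1.card_pos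
  -- Each tile costs at most `(S + ε) |F n|` since its index is at least `N`, and almost
  -- disjointness bounds the total size of the tiles by `|A| / (1 - ε)`.
  have hsum : ∑ p ∈ P, (k p.1 : ℝ) ≤ (S + ε) / (1 - ε) * A.card := by
    calc ∑ p ∈ P, (k p.1 : ℝ) ≤ ∑ p ∈ P, (S + ε) * ((F p.1).card : ℝ) :=
          Finset.sum_le_sum fun p hp => hkN _ (hI _ (hP p hp).1)
      _ = (S + ε) * ∑ p ∈ P, ((F p.1).card : ℝ) := (Finset.mul_sum _ _ _).symm
      _ ≤ (S + ε) * (A.card / (1 - ε)) := by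
          gcongr
          rw [le_div_iff₀ (by linarith)]
          linarith
      _ = (S + ε) / (1 - ε) * A.card := by ring
  have hreal : ((v + (∑ p ∈ P, k p.1 + (A \ tileUnion F P).card * d) : ℕ) : ℝ) ≤
      v + ((S + ε) / (1 - ε) + ε * d) * A.card := by
    push_cast
    have := mul_le_mul_of_nonneg_right hPrest (Nat.cast_nonneg (α := ℝ) d)
    linarith
  have hc0 : 0 ≤ (S + ε) / (1 - ε) + ε * d := by
    have : 0 < 1 - ε := by linarith
    positivity
  have hA0 : (A.card : ℝ≥0∞) ≠ 0 := by simpa using hA.1.ne_empty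
  have hAt : (A.card : ℝ≥0∞) ≠ ⊤ := ENNReal.natCast_ne_top _
  rw [ENNReal.div_le_iff hA0 hAt, add_mul, ENNReal.div_mul_cancel hA0 hAt, hv, ENat.toENNReal_coe]
  calc (coverDim (joinCover 𝒰 A) : ℝ≥0∞)
      ≤ ((v + (∑ p ∈ P, k p.1 + (A \ tileUnion F P).card * d) : ℕ) : ℝ≥0∞) := by
        rw [← ENat.toENNReal_coe]
        exact ENat.toENNReal_le.2 hbound
    _ ≤ ENNReal.ofReal (v + ((S + ε) / (1 - ε) + ε * d) * A.card) := by
        rw [← ENNReal.ofReal_natCast]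
        exact ENNReal.ofReal_le_ofReal hreal
    _ = v + ENNReal.ofReal ((S + ε) / (1 - ε) + ε * d) * A.card := by
        rw [ENNReal.ofReal_add (by positivity) (by positivity), ENNReal.ofReal_mul hc0,
          ENNReal.ofReal_natCast, ENNReal.ofReal_natCast]

end MeanDim

theorem mainTheorem10 {Γ Y G : Type*} [Group Γ] [Countable Γ] (hΓ : MeanDim.IsAmenable Γ)
    [TopologicalSpace Y] [CompactSpace Y] [TopologicalSpace.MetrizableSpace Y]
    [MulAction Γ Y] [ContinuousConstSMul Γ Y]
    [Group G] [TopologicalSpace G] [IsTopologicalGroup G] [CompactSpace G]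
    [TopologicalSpace.MetrizableSpace G]
    [MulDistribMulAction Γ G] [ContinuousConstSMul Γ G]
    (σ : MeanDim.Cocycle Γ Y G)
    (F : ℕ → Finset Γ) (hF : MeanDim.IsFolnerSeq F) :
    MeanDim.mdim Γ (MeanDim.SkewProduct σ) ≤
      MeanDim.mdim Γ Y +
        ⨆ y : Y, MeanDim.mdimOn F (MeanDim.SkewProduct.proj σ ⁻¹' {y}) := by
  rcases isEmpty_or_nonempty Y with hY | ⟨⟨y⟩⟩
  · have : IsEmpty (MeanDim.SkewProduct σ) := ⟨fun p => hY.false (MeanDim.SkewProduct.proj σ p)⟩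
    rw [MeanDim.mdim_eq_zero_of_isEmpty]
    exact zero_le
  let _ := TopologicalSpace.metrizableSpaceMetric Y
  let _ := TopologicalSpace.metrizableSpaceMetric G
  -- One arbitrary fiber suffices, so the supremum is replaced by its value at `y`.
  refine le_trans ?_ (add_le_add_right (le_iSup (fun y : Y =>
    MeanDim.mdimOn F (MeanDim.SkewProduct.proj σ ⁻¹' {y})) y) _)
  obtain ⟨S, hS⟩ : ∃ S, S = MeanDim.mdimOn F (MeanDim.SkewProduct.proj σ ⁻¹' {y}) := ⟨_, rfl⟩
  rw [← hS]
  by_cases hS_top : S = ⊤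
  · simp [hS_top]
  refine iSup₂_le fun 𝒰 h𝒰 => ?_
  obtain ⟨d, hd⟩ := h𝒰.exists_coverDimLE
  -- The bound `d` depends only on `𝒰`, which stays fixed as `ε → 0`.
  have hlim : Tendsto (fun ε : ℝ => MeanDim.mdim Γ Y +
      ENNReal.ofReal ((S.toReal + ε) / (1 - ε) + ε * d)) (𝓝[>] 0) (𝓝 (MeanDim.mdim Γ Y + S)) := by
    refine Tendsto.const_add _ ?_
    have hc : ContinuousAt (fun ε : ℝ => (S.toReal + ε) / (1 - ε) + ε * d) 0 := by
      refine ContinuousAt.add (ContinuousAt.div ?_ ?_ (by norm_num)) ?_ <;> fun_prop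
    have h0 := ENNReal.tendsto_ofReal (hc.tendsto.mono_left (nhdsWithin_le_nhds (s := Set.Ioi 0)))
    simpa [ENNReal.ofReal_toReal hS_top] using h0
  refine ge_of_tendsto hlim ?_
  filter_upwards [Ioo_mem_nhdsGT (show (0 : ℝ) < 1 / 2 by norm_num)] with ε hε
  exact MeanDim.SkewProduct.limsup_coverDim_le σ hF y h𝒰 hd
    (by rw [ENNReal.ofReal_toReal hS_top, hS]) ENNReal.toReal_nonneg hε.1 hε.2.le
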